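/- **Model.** Fix an integer $h\ge 0$ (the number of hierarchy levels) and parameters $\lambda_0,\lambda_1,\dots,\lambda_{h+1}>0$, and put $\alpha(h)=\frac{1}{3\cdot 2^h+1}$. A network of source-destination pairs (every node is both a source and a destination) consists of $c$ cells of $M=q^{2^h}$ nodes; for $0\le j<h$ each group of level $j$ (a cell is a group of level $0$) with $s^2$ nodes is divided into $s$ groups of level $j+1$ with $s$ nodes, so that a group of level $j$ has $M^{1/2^j}$ nodes and the smallest groups have $q$ nodes. A link between nodes of different cells has type $0$, between different level-$j$ groups of a common level-$(j-1)$ group type $j$ ($1\le j\le h$), and inside a smallest group type $h+1$. The delays of all uses of all links are independent, and those of type $j$ are exponential with parameter $\lambda_j$. **Scheme.** Time is divided into sessions. A session is a sequence of stages. In a stage a number of groups work in parallel; each group makes a number of transmissions one after the other; a transmission ends when each of its receivers has been served, and a receiver is served by the fastest of its links. The stage ends when the slowest group has finished. The stages are: * *Phase I:* the exchange $A_0$ in all cells in parallel. The exchange $A_h$, in which all packets of a smallest group are made known to all its nodes, is one stage: $q$ successive transmissions, each to the other $q-1$ nodes. For $j<h$, the exchange $A_j$ in the level-$j$ groups (of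 $s^2$ nodes) consists of: $A_{j+1}$ in all level-$(j+1)$ subgroups, which creates their preliminary mega packets; then a stage in which the $s$ subgroups of a group take turns, each sending its mega packet to the $s-1$ other subgroups, over $s^2$ links for each receiving subgroup; then $A_{j+1}$ again, for the $s-1$ mega packets received from the other subgroups (with $q-1$ in place of $q$ transmissions per smallest group if $j+1=h$). * *Phase II:* the $c$ cells take turns, each sending its mega packet to $M$ destination cells, over $M^2$ links for each destination cell. * *Phase III:* the delivery $B_0$ in all cells in parallel. The delivery $B_h$ in the smallest groups is one stage of $q$ successive transmissions, each to one node. For $j<h$, $B_j$ consists of: $A_{j+1}$ in all subgroups; a stage in which the $s$ subgroups of a group take turns, each sending to $s$ destination subgroups over $s^2$ links each; then $B_{j+1}$. In the *worsened* version of the scheme all groups that work in parallel also wait for each other after every single transmission, and the numbers $q-1$ and $s-1$ above are replaced by $q$ and $s$. **Age.** Let $Y_1,Y_2,\dots$ be the durations of the sessions, $T_0=0$ and $T_k=Y_1+\dots+Y_k$. Every source generates an update at the start $T_{k-1}$ of session $k$, and every destination updates its age at the end $T_k$ of the session. So the age at every destination is $\Delta(t)=t-u(t)$, where $u(t)$ is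 the timestamp of the most recent update taken into account up to time $t$ (with $u(t)=0$ before $T_1$). The per-user average age is $\Delta=\lim_{\tau\to\infty}\frac1\tau\int_0^\tau\Delta(t)\,dt$. **Theorem.** Let $q=q(n)$ and $c=c(n)$ be integers with $q(n)=\Theta(n^{\alpha(h)})$ and $c(n)=\Theta(n^{1-b})$, where $b=2^h\alpha(h)$ (that is, $b/2^h=1-3b$); so the cells have $\Theta(n^b)$ nodes and the network has $\Theta(n)$ nodes, and the integers may be rounded arbitrarily (for $n=m^{3\cdot 2^h+1}$, no rounding is needed: $q=m$ and $c=n/m^{2^h}$). Then, for the scheme with $h$ hierarchy levels and also for its worsened version, for all large $n$ the average age exists almost surely and equals a constant $\Delta_n$ (the same for all users), and $$\Delta_n=O\!\left(n^{\alpha(h)}\log n\right)\qquad(n\to\infty).$$ Moreover $\alpha(h)\to 0$ as $h\to\infty$, so that for each $n\ge 1$ the bound $n^{\alpha(h)}\log n$ tends to $\log n$ as $h\to\infty$. -/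

import Mathlib

open MeasureTheory ProbabilityTheory Filter Topology Asymptotics

namespace HierarchicalAge

/-- The exponent `α(h) = 1 / (3 * 2 ^ h + 1)`. -/
noncomputable def ageExponent (h : ℕ) : ℝ := 1 / (3 * 2 ^ h + 1)

/-- The two versions of the session time.
* `original`: in every stage, simultaneously working groups proceed through their turns on their
  own and wait for the slowest group only at the end of the stage;
* `worsened`: the upper bound on the session time, in which all simultaneously working groups
  wait for each other after every turn, and in which a node (group) that has to reach all the
  other nodes (groups) of a collection of `m` is charged for `m` of them instead of `m - 1`. -/
inductive Variant where
  | original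
  | worsened

/-- Number of receivers charged for when one member of a collection of `m` has to reach all
the others. -/
def Variant.others : Variant → ℕ → ℕ
  | original, m => m - 1
  | worsened, m => m

/-- A stage of a session. `groups` groups work in parallel; inside a group `turns` transmissions
are made one after the other; a transmission ends once each of its `targets` receivers
has been served, and a receiver is served by the fastest of `links` links. All links of the stage
are of type `level`. -/
structure Stage where
  level : ℕ
  groups : ℕ
  turns : ℕ
  targets : ℕ
  links : ℕ

/-- Phase I and Phase III': inside each of `g` parallel groups of `q ^ (2 ^ d)` nodes, every node
has a packet, and all packets are to be made known to all nodes of the group.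

* `d = 0`: simple time division, the nodes of the group transmit one after the other; `k` is the
  number of packets to be sent in a group.
* `d + 1`: each group of `s ^ 2` nodes, `s = q ^ (2 ^ d)`, consists of `s` subgroups of `s` nodes.
  First the packets are exchanged inside all subgroups, which creates the preliminary mega
  packets of the subgroups. Then the subgroups of a group take turns: all `s` nodes
  of a subgroup send its mega packet to the other subgroups, until in each of them the earliest of
  its `s` nodes has received it (`s * s` links for each receiving subgroup). Finally the mega
  packets received from the other subgroups are made known to all nodes of the subgroup.

`ℓ` is the type of the links between the subgroups of a group (inside the group, if `d = 0`). -/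
def allToAll (v : Variant) (q : ℕ) : (d g ℓ k : ℕ) → List Stage
  | 0, g, ℓ, k => [⟨ℓ, g, k, v.others q, 1⟩]
  | d + 1, g, ℓ, _ =>
      allToAll v q d (g * q ^ 2 ^ d) (ℓ + 1) q
        ++ [⟨ℓ, g, q ^ 2 ^ d, v.others (q ^ 2 ^ d), (q ^ 2 ^ d) ^ 2⟩]
        ++ allToAll v q d (g * q ^ 2 ^ d) (ℓ + 1) (v.others q)

/-- Phase III: inside each of `g` parallel groups of `q ^ (2 ^ d)` nodes, every node holds one
packet, which has to be brought to its destination node in the group.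

* `d = 0`: simple time division, one single-receiver transmission for each packet.
* `d + 1`: with `s = q ^ (2 ^ d)` as before, first the packets are exchanged inside all subgroups,
  which creates the secondary mega packets. Then the subgroups of a group take turns
  and send their mega packets to the `s` destination subgroups of the `s` packets
  they contain. Finally the packets are relayed to their destinations inside the subgroups. -/
def relay (v : Variant) (q : ℕ) : (d g ℓ : ℕ) → List Stage
  | 0, g, ℓ => [⟨ℓ, g, q, 1, 1⟩]
  | d + 1, g, ℓ =>
      allToAll v q d (g * q ^ 2 ^ d) (ℓ + 1) q
        ++ [⟨ℓ, g, q ^ 2 ^ d, q ^ 2 ^ d, (q ^ 2 ^ d) ^ 2⟩]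
        ++ relay v q d (g * q ^ 2 ^ d) (ℓ + 1)

/-- The stages of one session of the scheme with `h` hierarchy levels in a network of `c` cells of
`M = q ^ (2 ^ h)` nodes each; the groups of the `j`-th hierarchy level have
`M ^ (1 / 2 ^ j) = q ^ (2 ^ (h - j))` nodes. Phase I creates the mega packets of the cells; in
Phase II the cells take turns and send their mega packets to the `M` destination cells of the `M`
packets they contain, over `M * M` links for each destination cell; Phase III delivers the packets
inside the cells. Links between cells have type `0`, links between the `j`-th level groups of a
common `(j - 1)`-st level group have type `j`, for `1 ≤ j ≤ h`, and links inside the smallest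
groups have type `h + 1`. -/
def stages (v : Variant) (h q c : ℕ) : List Stage :=
  allToAll v q h c 1 q
    ++ [⟨0, 1, c, q ^ 2 ^ h, (q ^ 2 ^ h) ^ 2⟩]
    ++ relay v q h c 1

/-- The label of a use of a link: number of the session, position of the stage in the session,
group, turn, receiver and link. -/
structure Transmission where
  session : ℕ
  stage : ℕ
  group : ℕ
  turn : ℕ
  target : ℕ
  link : ℕ

/-- The duration of a stage, when the link delays are `x group turn target link`. Suprema and
infima are maxima and minima over finite sets (a maximum over the empty set is `0`). -/
noncomputable def stageTime (v : Variant) (s : Stage) (x : ℕ → ℕ → ℕ → ℕ → ℝ) : ℝ :=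
  match v with
  | .original =>
      ⨆ g : Fin s.groups, ∑ t : Fin s.turns, ⨆ r : Fin s.targets, ⨅ l : Fin s.links, x g t r l
  | .worsened =>
      ∑ t : Fin s.turns, ⨆ g : Fin s.groups, ⨆ r : Fin s.targets, ⨅ l : Fin s.links, x g t r l

/-- The duration of session `k`, when the delay of a link of type `j` in its use `i` is `x j i`. -/
noncomputable def sessionTime (v : Variant) (h q c : ℕ) (x : ℕ → Transmission → ℝ) (k : ℕ) : ℝ :=
  ∑ i : Fin (stages v h q c).length,
    stageTime v ((stages v h q c).get i)
      fun g t r l => x ((stages v h q c).get i).level ⟨k, i, g, t, r, l⟩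

/-- The link delays: `X j i` is the delay of a link of type `j` in its use `i`. All of them are
independent, and those of type `j` are exponential with parameter `lam j`. -/
structure IsDelayFamily {Ω : Type*} [MeasurableSpace Ω] (P : Measure Ω) (lam : ℕ → ℝ)
    (X : ℕ → Transmission → Ω → ℝ) : Prop where
  measurable : ∀ j i, Measurable (X j i)
  indep : iIndepFun (fun p : ℕ × Transmission => X p.1 p.2) P
  law : ∀ j i, P.map (X j i) = expMeasure (lam j)

/-- The starting time of session `k` (and the end of the session before it), when the sessions
have durations `Y 0, Y 1, …`. -/
noncomputable def sessionStart (Y : ℕ → ℝ) (k : ℕ) : ℝ := ∑ j ∈ Finset.range k, Y j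

/-- The timestamp of the most recent update at a destination node at time `t`. In session `k` the
update generated at the start of the session is received, and it is taken
into account at the end of the session. Before that, the node has an update of timestamp `0`. -/
noncomputable def timestamp (Y : ℕ → ℝ) (t : ℝ) : ℝ :=
  sSup (insert 0 {u | ∃ k, sessionStart Y (k + 1) ≤ t ∧ u = sessionStart Y k})

/-- The age at a destination node at time `t`. -/
noncomputable def age (Y : ℕ → ℝ) (t : ℝ) : ℝ := t - timestamp Y t

/-- The long-run time average of the age at a destination node exists and equals `a`. -/
def HasAverageAge (Y : ℕ → ℝ) (a : ℝ) : Prop :=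
  (∀ τ : ℝ, IntervalIntegrable (age Y) volume 0 τ) ∧
    Tendsto (fun τ : ℝ => 1 / τ * ∫ t in (0 : ℝ)..τ, age Y t) atTop (𝓝 a)

end HierarchicalAge

/-!
The session durations `Y` of the scheme are independent and identically distributed, since the uses
of links in different sessions are different. During session `k` the age starts at `Y (k - 1)` and
grows with slope one, so its integral over the session is `Y (k - 1) * Y k + Y k ^ 2 / 2`. The
strong law of large numbers, applied to the durations, to their squares and to the products of
consecutive durations (split by parity, which makes the products pairwise independent), gives the
average age `E Y + E Y² / (2 E Y)` (`ae_hasAverageAge`). It remains to show that, with `y = n ^ α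
log n`, both `E Y ≥ b y` and `E Y² ≤ (a y)²` for some constants `a` and `b > 0`
(`exists_duration_bounds`).

*Upper bound.* The fastest of `L` links is exponential with parameter `L r`, and the maximum of `N`
exponential variables of parameter `r` has `L²`-norm `O((log N + 1) / r)`, by an exponential moment.
A stage is at most the sum over its turns of the maximum over all receivers in all groups, so its
`L²`-norm is at most of the order of `turns / links * log (groups * targets)`
(`IsExpArray.secondMomentLE_stageTime`). In all stages `groups * targets` is at most the number
`c M = Θ(n)` of nodes, and `turns / links` is at most `q` inside the cells and `c / M²` between
cells; both are `O(n ^ α)` (`bounded_of_mem_stages`, `exists_network_bounds`). The number of stages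
depends on `h` only.

*Lower bound.* Every session contains a time division stage in the smallest groups, with `q` turns
and `q - 1` or `q` receivers in each of them, of mean at least of order `q log q`, which has the
order of `y` (`IsExpArray.le_integral_stageTime`). The logarithm matters here: the bound
`E Y ≥ const * q` alone would leave a factor `log n` too many in `E Y² / E Y`.

All moments are computed under the product law `delayLaw` of the delays of one session, so that the
average age does not depend on the probability space.
-/

namespace HierarchicalAge

/-! ### The age process of a fixed sequence of session durations -/

section Age

variable {Y : ℕ → ℝ}

lemma sessionStart_zero : sessionStart Y 0 = 0 := by simp [sessionStart]

lemma sessionStart_succ (k : ℕ) : sessionStart Y (k + 1) = sessionStart Y k + Y k :=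
  Finset.sum_range_succ _ _

lemma sessionStart_mono (hY : ∀ k, 0 ≤ Y k) : Monotone (sessionStart Y) :=
  monotone_nat_of_le_succ fun k => by rw [sessionStart_succ]; linarith [hY k]

lemma sessionStart_nonneg (hY : ∀ k, 0 ≤ Y k) (k : ℕ) : 0 ≤ sessionStart Y k :=
  Finset.sum_nonneg fun i _ => hY i

/-- During session `k` the timestamp is the start of session `k - 1`; the truncated subtraction
covers session `0`, in which the timestamp is `0 = sessionStart Y 0`. -/
lemma timestamp_eq (hY : ∀ k, 0 ≤ Y k) {k : ℕ} {t : ℝ} (h1 : sessionStart Y k ≤ t)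
    (h2 : t < sessionStart Y (k + 1)) : timestamp Y t = sessionStart Y (k - 1) := by
  refine IsGreatest.csSup_eq ⟨?_, ?_⟩
  · cases k with
    | zero => exact Or.inl sessionStart_zero
    | succ j => exact Or.inr ⟨j, h1, rfl⟩
  · rintro u (rfl | ⟨j, hj, rfl⟩)
    · exact sessionStart_nonneg hY _
    · have : j + 1 < k + 1 := (sessionStart_mono hY).reflect_lt (hj.trans_lt h2)
      exact sessionStart_mono hY (by omega)

lemma mem_upperBounds_timestamp (hY : ∀ k, 0 ≤ Y k) (t : ℝ) :
    max 0 t ∈ upperBounds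
      (insert 0 {u | ∃ k, sessionStart Y (k + 1) ≤ t ∧ u = sessionStart Y k}) := by
  rintro u (rfl | ⟨j, hj, rfl⟩)
  · exact le_max_left _ _
  · exact ((sessionStart_mono hY j.le_succ).trans hj).trans (le_max_right _ _)

lemma timestamp_mono (hY : ∀ k, 0 ≤ Y k) : Monotone (timestamp Y) := fun _ t hst =>
  csSup_le_csSup ⟨_, mem_upperBounds_timestamp hY t⟩ ⟨0, Or.inl rfl⟩ <|
    Set.insert_subset_insert fun _ ⟨k, hk, hu⟩ => ⟨k, hk.trans hst, hu⟩

lemma age_nonneg (hY : ∀ k, 0 ≤ Y k) {t : ℝ} (ht : 0 ≤ t) : 0 ≤ age Y t := by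
  have : timestamp Y t ≤ max 0 t := csSup_le ⟨0, Or.inl rfl⟩ (mem_upperBounds_timestamp hY t)
  rw [max_eq_right ht] at this
  exact sub_nonneg.2 this

lemma intervalIntegrable_age (hY : ∀ k, 0 ≤ Y k) (a b : ℝ) :
    IntervalIntegrable (age Y) volume a b :=
  intervalIntegral.intervalIntegrable_id.sub (timestamp_mono hY).intervalIntegrable

/-- The integral of the age over one session: the age starts at `T k - T (k - 1)` and grows
linearly. -/
lemma integral_age_session (hY : ∀ k, 0 ≤ Y k) (k : ℕ) :
    ∫ t in sessionStart Y k..sessionStart Y (k + 1), age Y t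
      = (sessionStart Y k - sessionStart Y (k - 1)) * Y k + Y k ^ 2 / 2 := by
  have hle := sessionStart_mono hY k.le_succ
  have : ∫ t in sessionStart Y k..sessionStart Y (k + 1), age Y t
      = ∫ t in sessionStart Y k..sessionStart Y (k + 1), (t - sessionStart Y (k - 1)) := by
    rw [intervalIntegral.integral_of_le hle, intervalIntegral.integral_of_le hle,
      integral_Ioc_eq_integral_Ioo, integral_Ioc_eq_integral_Ioo]
    refine setIntegral_congr_fun measurableSet_Ioo fun t ht => ?_
    simp only [age, timestamp_eq hY ht.1.le ht.2]
  rw [this, intervalIntegral.integral_sub intervalIntegral.intervalIntegrable_id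
    intervalIntegrable_const, integral_id, intervalIntegral.integral_const, sessionStart_succ,
    smul_eq_mul]
  ring

/-- The integral of the age over the first `k + 1` sessions. -/
lemma integral_age_sessionStart (hY : ∀ k, 0 ≤ Y k) (k : ℕ) :
    ∫ t in (0 : ℝ)..sessionStart Y (k + 1), age Y t
      = ∑ j ∈ Finset.range k, Y j * Y (j + 1) + (∑ j ∈ Finset.range (k + 1), Y j ^ 2) / 2 := by
  induction k with
  | zero =>
    have := integral_age_session hY 0
    rw [sessionStart_zero] at this
    simp [this]
  | succ k ih =>
    rw [← intervalIntegral.integral_add_adjacent_intervals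
      (intervalIntegrable_age hY 0 (sessionStart Y (k + 1))) (intervalIntegrable_age hY _ _), ih,
      integral_age_session hY, Finset.sum_range_succ (fun j => Y j * Y (j + 1)) k,
      Finset.sum_range_succ (fun j => Y j ^ 2) (k + 1), Nat.add_sub_cancel, sessionStart_succ k]
    ring

/-- A renewal-type limit: the time average of a nonnegative monotone function is determined by its
values along a sequence of times that grows linearly. -/
lemma tendsto_div_of_tendsto_along {F : ℝ → ℝ} (hF : MonotoneOn F (Set.Ici 0))
    (hF0 : ∀ t, 0 ≤ t → 0 ≤ F t) {T : ℕ → ℝ} (hT0 : ∀ k, 0 ≤ T k)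
    {m a : ℝ} (hm : 0 < m) (hT : Tendsto (fun k : ℕ => T k / k) atTop (𝓝 m))
    (hFT : Tendsto (fun k : ℕ => F (T k) / k) atTop (𝓝 a)) (hTm : Monotone T) :
    Tendsto (fun τ => 1 / τ * F τ) atTop (𝓝 (a / m)) := by
  have hTtop : Tendsto T atTop atTop := by
    refine (hT.pos_mul_atTop hm tendsto_natCast_atTop_atTop).congr' ?_
    filter_upwards [eventually_ne_atTop 0] with k hk
    field_simp
  -- `N τ` is the number of the interval `[T k, T (k + 1))` that contains `τ`.
  have hex : ∀ τ : ℝ, ∃ k, τ < T (k + 1) ∧ (T 0 ≤ τ → T k ≤ τ) := by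
    intro τ
    have h : ∃ k, τ < T (k + 1) :=
      (((tendsto_add_atTop_iff_nat 1).2 hTtop).eventually_gt_atTop τ).exists
    classical
    refine ⟨Nat.find h, Nat.find_spec h, fun h0 => ?_⟩
    rcases hn : Nat.find h with _ | j
    · exact h0
    · exact not_lt.1 (Nat.find_min h (by omega : j < Nat.find h))
  choose N hN1 hN2 using hex
  have hN : Tendsto N atTop atTop := by
    refine tendsto_atTop.2 fun K => ?_
    filter_upwards [eventually_ge_atTop (T K)] with τ hτ
    have := hTm.reflect_lt (hτ.trans_lt (hN1 τ))
    omega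
  have hk1 : Tendsto (fun k : ℕ => ((k + 1 : ℕ) : ℝ) / k) atTop (𝓝 1) := by
    have h := (tendsto_const_nhds (x := (1 : ℝ))).add tendsto_one_div_atTop_nhds_zero_nat
    rw [add_zero] at h
    refine h.congr' ?_
    filter_upwards [eventually_ne_atTop 0] with k hk
    push_cast
    field_simp
  have hT' := (tendsto_add_atTop_iff_nat 1).2 hT
  have hFT' := (tendsto_add_atTop_iff_nat 1).2 hFT
  have hlow : Tendsto (fun k => F (T k) / T (k + 1)) atTop (𝓝 (a / m)) := by
    have h := (hFT.div hT' hm.ne').div hk1 one_ne_zero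
    rw [div_one] at h
    refine h.congr' ?_
    filter_upwards [eventually_ne_atTop 0,
      ((tendsto_add_atTop_iff_nat 1).2 hTtop).eventually_gt_atTop 0] with k hk hpos
    simp only [Pi.div_apply]
    field_simp
  have hup : Tendsto (fun k => F (T (k + 1)) / T k) atTop (𝓝 (a / m)) := by
    have h := (hFT'.div hT hm.ne').mul hk1
    rw [mul_one] at h
    refine h.congr' ?_
    filter_upwards [eventually_ne_atTop 0, hTtop.eventually_gt_atTop 0] with k hk hpos
    simp only [Pi.div_apply]
    field_simp
  refine tendsto_of_tendsto_of_tendsto_of_le_of_le' (hlow.comp hN) (hup.comp hN) ?_ ?_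
  · filter_upwards [eventually_ge_atTop (T 0), eventually_gt_atTop 0] with τ h0 hτ
    rw [one_div_mul_eq_div]
    exact div_le_div₀ (hF0 _ hτ.le) (hF (hT0 _) hτ.le (hN2 τ h0)) hτ (hN1 τ).le
  · filter_upwards [eventually_ge_atTop (T 0), eventually_gt_atTop 0,
      (hTtop.comp hN).eventually_gt_atTop 0] with τ h0 hτ hpos
    rw [one_div_mul_eq_div]
    exact div_le_div₀ (hF0 _ (hT0 _)) (hF hτ.le (hT0 _) (hN1 τ).le) hpos (hN2 τ h0)

lemma sum_range_two_mul (f : ℕ → ℝ) (k : ℕ) :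
    ∑ j ∈ Finset.range (2 * k), f j
      = ∑ i ∈ Finset.range k, f (2 * i) + ∑ i ∈ Finset.range k, f (2 * i + 1) := by
  induction k with
  | zero => simp
  | succ k ih =>
    rw [mul_add, mul_one, Finset.sum_range_succ, Finset.sum_range_succ, ih, Finset.sum_range_succ,
      Finset.sum_range_succ]
    ring

/-- The average age in terms of the empirical averages of the durations, of their squares and of
the products of consecutive durations. The products are averaged separately over even and odd
positions, which for independent durations gives sums of independent terms. -/
lemma hasAverageAge_of_tendsto (hY : ∀ k, 0 ≤ Y k) {m m₂ : ℝ} (hm : 0 < m)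
    (h1 : Tendsto (fun n : ℕ => (∑ j ∈ Finset.range n, Y j) / n) atTop (𝓝 m))
    (h2 : Tendsto (fun n : ℕ => (∑ j ∈ Finset.range n, Y j ^ 2) / n) atTop (𝓝 m₂))
    (heven : Tendsto (fun n : ℕ => (∑ i ∈ Finset.range n, Y (2 * i) * Y (2 * i + 1)) / n) atTop
      (𝓝 (m ^ 2)))
    (hodd : Tendsto (fun n : ℕ => (∑ i ∈ Finset.range n, Y (2 * i + 1) * Y (2 * i + 2)) / n) atTop
      (𝓝 (m ^ 2))) :
    HasAverageAge Y (m + m₂ / (2 * m)) := by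
  refine ⟨intervalIntegrable_age hY 0, ?_⟩
  have hint := intervalIntegrable_age hY
  have hF0 : ∀ a b : ℝ, 0 ≤ a → a ≤ b → 0 ≤ ∫ t in a..b, age Y t := fun a b ha hab =>
    intervalIntegral.integral_nonneg hab fun t ht => age_nonneg hY (ha.trans ht.1)
  have hmono : MonotoneOn (fun τ => ∫ t in (0 : ℝ)..τ, age Y t) (Set.Ici 0) := by
    intro a ha b _ hab
    have := intervalIntegral.integral_add_adjacent_intervals (hint 0 a) (hint a b)
    have := hF0 a b ha hab
    simp only
    linarith
  have hsub : Tendsto (fun k : ℕ => 2 * k + 1) atTop atTop :=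
    tendsto_atTop_mono (fun k => (by omega : k ≤ 2 * k + 1)) tendsto_id
  have h2k : Tendsto (fun k : ℕ => ((2 * k + 1 : ℕ) : ℝ) / k) atTop (𝓝 2) := by
    have h := (tendsto_const_nhds (x := (2 : ℝ))).add tendsto_one_div_atTop_nhds_zero_nat
    rw [add_zero] at h
    refine h.congr' ?_
    filter_upwards [eventually_ne_atTop 0] with k hk
    push_cast
    field_simp
  have hT : Tendsto (fun k : ℕ => sessionStart Y (2 * k + 1) / k) atTop (𝓝 (m * 2)) := by
    refine ((h1.comp hsub).mul h2k).congr' ?_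
    filter_upwards [eventually_ne_atTop 0] with k hk
    have : ((2 * k + 1 : ℕ) : ℝ) ≠ 0 := by positivity
    simp only [Function.comp_apply, sessionStart]
    field_simp
  have hFT : Tendsto (fun k : ℕ => (∫ t in (0 : ℝ)..sessionStart Y (2 * k + 1), age Y t) / k) atTop
      (𝓝 (m ^ 2 + m ^ 2 + m₂ * 2 / 2)) := by
    refine ((heven.add hodd).add (((h2.comp hsub).mul h2k).div_const 2)).congr' ?_
    filter_upwards [eventually_ne_atTop 0] with k hk
    have : ((2 * k + 1 : ℕ) : ℝ) ≠ 0 := by positivity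
    rw [integral_age_sessionStart hY, sum_range_two_mul]
    simp only [Function.comp_apply]
    field_simp
  have := tendsto_div_of_tendsto_along hmono (fun t ht => hF0 0 t le_rfl ht)
    (fun k => sessionStart_nonneg hY (2 * k + 1)) (by positivity) hT hFT
    fun i j hij => sessionStart_mono hY (by omega)
  convert this using 2
  field_simp
  ring

end Age

/-! ### Independent and identically distributed sessions -/

/-- If the session durations are independent and identically distributed with a finite second
moment, then the average age is almost surely `E Y + E Y² / (2 E Y)`. -/
lemma ae_hasAverageAge {Ω : Type*} [MeasurableSpace Ω] {P : Measure Ω} [IsProbabilityMeasure P]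
    {Y : ℕ → Ω → ℝ} (hmeas : ∀ k, Measurable (Y k)) (hind : iIndepFun Y P)
    (hid : ∀ k, IdentDistrib (Y k) (Y 0) P P) (hL : MemLp (Y 0) 2 P) (hnn : ∀ᵐ ω ∂P, ∀ k, 0 ≤ Y k ω)
    (hm : 0 < ∫ ω, Y 0 ω ∂P) :
    ∀ᵐ ω ∂P, HasAverageAge (fun k => Y k ω)
      ((∫ ω, Y 0 ω ∂P) + (∫ ω, Y 0 ω ^ 2 ∂P) / (2 * ∫ ω, Y 0 ω ∂P)) := by
  have hint : ∀ k, Integrable (Y k) P := fun k =>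
    (hid k).integrable_iff.2 (hL.integrable one_le_two)
  have hmean : ∀ k, ∫ ω, Y k ω ∂P = ∫ ω, Y 0 ω ∂P := fun k => (hid k).integral_eq
  have h1 := strong_law_ae_real Y (hint 0) (fun i j hij => hind.indepFun hij) hid
  have h2 := strong_law_ae_real (fun k ω => Y k ω ^ 2) hL.integrable_sq
    (fun i j hij => (hind.indepFun hij).comp (measurable_id.pow_const 2)
      (measurable_id.pow_const 2))
    (fun k => (hid k).comp (measurable_id.pow_const 2))
  have hprod : ∀ a : ℕ, ∀ᵐ ω ∂P, Tendsto (fun n : ℕ =>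
      (∑ i ∈ Finset.range n, Y (2 * i + a) ω * Y (2 * i + a + 1) ω) / n) atTop
      (𝓝 ((∫ ω, Y 0 ω ∂P) ^ 2)) := by
    intro a
    have hindep : ∀ k, IndepFun (Y k) (Y (k + 1)) P := fun k => hind.indepFun (by omega)
    have hident : ∀ i, IdentDistrib (fun ω => Y (2 * i + a) ω * Y (2 * i + a + 1) ω)
        (fun ω => Y (2 * 0 + a) ω * Y (2 * 0 + a + 1) ω) P P := fun i =>
      (IdentDistrib.prodMk ((hid _).trans (hid _).symm) ((hid _).trans (hid _).symm)
        (hindep _) (hindep _)).comp (measurable_fst.mul measurable_snd)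
    have h := strong_law_ae_real (fun i ω => Y (2 * i + a) ω * Y (2 * i + a + 1) ω)
      ((hindep _).integrable_mul (hint _) (hint _))
      (fun i j hij => by
        have h0 := hind.indepFun_prodMk_prodMk hmeas (2 * i + a) (2 * i + a + 1) (2 * j + a)
          (2 * j + a + 1) (by omega) (by omega) (by omega) (by omega)
        exact h0.comp (measurable_fst.mul measurable_snd) (measurable_fst.mul measurable_snd))
      hident
    have hval : ∫ ω, Y (2 * 0 + a) ω * Y (2 * 0 + a + 1) ω ∂P = (∫ ω, Y 0 ω ∂P) ^ 2 := by
      rw [(hindep (2 * 0 + a)).integral_fun_mul_eq_mul_integral (hint _).1 (hint _).1,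
        hmean (2 * 0 + a), hmean (2 * 0 + a + 1), sq]
    rw [hval] at h
    exact h
  filter_upwards [h1, h2, hprod 0, hprod 1, hnn] with ω a1 a2 a3 a4 a5
  exact hasAverageAge_of_tendsto a5 hm a1 a2 a3 a4

/-! ### Second moment bounds -/

section Moments

variable {Ω : Type*} [MeasurableSpace Ω] {P : Measure Ω}

/-- `SecondMomentLE P Z B`: the random variable `Z` is almost surely nonnegative and
square-integrable, with `L²`-norm at most `B`. The bound on the norm is stated in squared form. -/
structure SecondMomentLE (P : Measure Ω) (Z : Ω → ℝ) (B : ℝ) : Prop where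
  measurable : Measurable Z
  nonneg : ∀ᵐ ω ∂P, 0 ≤ Z ω
  integrable_sq : Integrable (fun ω => Z ω ^ 2) P
  integral_sq_le : ∫ ω, Z ω ^ 2 ∂P ≤ B ^ 2

lemma SecondMomentLE.memLp {Z : Ω → ℝ} {B : ℝ} (hZ : SecondMomentLE P Z B) : MemLp Z 2 P :=
  (memLp_two_iff_integrable_sq hZ.measurable.aestronglyMeasurable).2 hZ.integrable_sq

lemma SecondMomentLE.mono {Z Z' : Ω → ℝ} {B B' : ℝ} (hZ : SecondMomentLE P Z B)
    (hm : Measurable Z') (h0 : ∀ᵐ ω ∂P, 0 ≤ Z' ω) (hle : ∀ᵐ ω ∂P, Z' ω ≤ Z ω) (hB0 : 0 ≤ B)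
    (hB : B ≤ B') : SecondMomentLE P Z' B' := by
  have hsq : ∀ᵐ ω ∂P, Z' ω ^ 2 ≤ Z ω ^ 2 := by
    filter_upwards [h0, hle] with ω a b using pow_le_pow_left₀ a b 2
  have hi : Integrable (fun ω => Z' ω ^ 2) P :=
    hZ.integrable_sq.mono' (hm.pow_const 2).aestronglyMeasurable <| by
      filter_upwards [hsq] with ω a
      rwa [Real.norm_of_nonneg (sq_nonneg _)]
  exact ⟨hm, h0, hi, ((integral_mono_ae hi hZ.integrable_sq hsq).trans hZ.integral_sq_le).trans
    (pow_le_pow_left₀ hB0 hB 2)⟩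

lemma SecondMomentLE.sum {n : ℕ} {Z : Fin n → Ω → ℝ} {B : ℝ}
    (hZ : ∀ i, SecondMomentLE P (Z i) B) : SecondMomentLE P (fun ω => ∑ i, Z i ω) (n * B) := by
  have hle : ∀ ω, (∑ i, Z i ω) ^ 2 ≤ n * ∑ i, Z i ω ^ 2 := fun ω => by
    simpa using sq_sum_le_card_mul_sum_sq (s := Finset.univ) (f := fun i => Z i ω)
  have hm : Measurable fun ω => ∑ i, Z i ω :=
    Finset.measurable_sum _ fun i _ => (hZ i).measurable
  have hi : Integrable (fun ω => n * ∑ i, Z i ω ^ 2) P :=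
    (integrable_finsetSum _ fun i _ => (hZ i).integrable_sq).const_mul _
  have hi' : Integrable (fun ω => (∑ i, Z i ω) ^ 2) P :=
    hi.mono' (hm.pow_const 2).aestronglyMeasurable <| .of_forall fun ω => by
      rw [Real.norm_of_nonneg (sq_nonneg _)]; exact hle ω
  refine ⟨hm, ?_, hi', ?_⟩
  · filter_upwards [ae_all_iff.2 fun i => (hZ i).nonneg] with ω h
    exact Finset.sum_nonneg fun i _ => h i
  · calc ∫ ω, (∑ i, Z i ω) ^ 2 ∂P ≤ ∫ ω, n * ∑ i, Z i ω ^ 2 ∂P := integral_mono hi' hi hle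
      _ = n * ∑ i, ∫ ω, Z i ω ^ 2 ∂P := by
        rw [integral_const_mul, integral_finsetSum _ fun i _ => (hZ i).integrable_sq]
      _ ≤ n * ∑ _i : Fin n, B ^ 2 := by gcongr with i; exact (hZ i).integral_sq_le
      _ = (n * B) ^ 2 := by simp; ring

/-- Bounding a square by an exponential moment: an exponential moment of at most `K` makes
`θ Z` exceed `log K` by `O(1)` only, in `L²`. -/
lemma SecondMomentLE.of_integral_exp_le [IsProbabilityMeasure P] {Z : Ω → ℝ} (hm : Measurable Z)
    (h0 : ∀ᵐ ω ∂P, 0 ≤ Z ω) {θ K : ℝ} (hθ : 0 < θ) (hK : 1 ≤ K)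
    (hi : Integrable (fun ω => Real.exp (θ * Z ω)) P)
    (hle : ∫ ω, Real.exp (θ * Z ω) ∂P ≤ K) :
    SecondMomentLE P Z (2 / θ * (Real.log K + 1)) := by
  set a := Real.log K with ha
  have ha0 : 0 ≤ a := Real.log_nonneg hK
  have hexp : Real.exp (-a) = K⁻¹ := by rw [Real.exp_neg, Real.exp_log (by linarith)]
  have hpt : ∀ᵐ ω ∂P, Z ω ^ 2 ≤ (2 * a ^ 2 + 4 * K⁻¹ * Real.exp (θ * Z ω)) / θ ^ 2 := by
    filter_upwards [h0] with ω hω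
    rw [le_div_iff₀ (by positivity), ← mul_pow, mul_comm (Z ω), ← hexp, mul_assoc, ← Real.exp_add]
    have hW : 0 ≤ θ * Z ω := by positivity
    generalize θ * Z ω = W at hW
    -- For `W ≥ a`, `W ^ 2 ≤ 2 a ^ 2 + 2 (W - a) ^ 2` and `(W - a) ^ 2 ≤ 2 exp (W - a)`.
    rcases le_total W a with h | h
    · have := Real.exp_pos (-a + W)
      nlinarith
    · have := Real.quadratic_le_exp_of_nonneg (sub_nonneg.2 h)
      rw [neg_add_eq_sub]
      nlinarith [sq_nonneg (W - 2 * a)]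
  have hib : Integrable (fun ω => (2 * a ^ 2 + 4 * K⁻¹ * Real.exp (θ * Z ω)) / θ ^ 2) P :=
    ((integrable_const _).add (hi.const_mul _)).div_const _
  have his : Integrable (fun ω => Z ω ^ 2) P :=
    hib.mono' (hm.pow_const 2).aestronglyMeasurable <| by
      filter_upwards [hpt] with ω h
      rwa [Real.norm_of_nonneg (sq_nonneg _)]
  refine ⟨hm, h0, his, (integral_mono_ae his hib hpt).trans ?_⟩
  rw [integral_div, integral_add (integrable_const _) (hi.const_mul _),
    integral_const_mul (4 * K⁻¹), integral_const, probReal_univ, one_smul, mul_pow, div_pow,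
    div_mul_eq_mul_div]
  have hK' : K⁻¹ * ∫ ω, Real.exp (θ * Z ω) ∂P ≤ 1 := by
    rw [inv_mul_le_iff₀ (by linarith)]; linarith
  gcongr
  nlinarith

end Moments

/-! ### Minima and maxima of exponential random variables -/

section Exponential

lemma integrable_exp_half_expMeasure {r : ℝ} (hr : 0 < r) :
    Integrable (fun x => Real.exp (r / 2 * x)) (expMeasure r) ∧
      ∫ x, Real.exp (r / 2 * x) ∂expMeasure r = 2 := by
  have hpdf : Measurable (gammaPDF 1 r) := (measurable_gammaPDFReal 1 r).ennreal_ofReal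
  have hlin : ∫⁻ x, ENNReal.ofReal (Real.exp (r / 2 * x)) ∂expMeasure r = 2 := by
    rw [expMeasure, gammaMeasure, lintegral_withDensity_eq_lintegral_mul _ hpdf (by fun_prop)]
    have : ∀ x : ℝ, (gammaPDF 1 r * fun x => ENNReal.ofReal (Real.exp (r / 2 * x))) x
        = 2 * exponentialPDF (r / 2) x := by
      -- The integrand is twice the exponential density of parameter `r / 2`.
      intro x
      have h2 : (2 : ENNReal) = ENNReal.ofReal 2 := by simp
      rw [Pi.mul_apply]
      change exponentialPDF r x * _ = _
      rw [exponentialPDF_eq, exponentialPDF_eq, h2]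
      split_ifs with h
      · rw [← ENNReal.ofReal_mul (by positivity), ← ENNReal.ofReal_mul (by positivity), mul_assoc,
          ← Real.exp_add, ← mul_assoc]
        congr 2
        · ring
        · ring_nf
      · simp
    simp_rw [this]
    rw [lintegral_const_mul _ (by
      exact (measurable_exponentialPDFReal _).ennreal_ofReal),
      lintegral_exponentialPDF_eq_one (half_pos hr), mul_one]
  have hae : AEStronglyMeasurable (fun x => Real.exp (r / 2 * x)) (expMeasure r) :=
    (by fun_prop : Measurable fun x => Real.exp (r / 2 * x)).aestronglyMeasurable
  have hpos : 0 ≤ᵐ[expMeasure r] fun x => Real.exp (r / 2 * x) :=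
    .of_forall fun x => (Real.exp_pos _).le
  refine ⟨⟨hae, ?_⟩, ?_⟩
  · rw [hasFiniteIntegral_iff_ofReal hpos, hlin]
    exact ENNReal.ofNat_lt_top
  · rw [integral_eq_lintegral_of_nonneg_ae hpos hae, hlin]
    rfl

lemma expMeasure_real_Ioi {r : ℝ} (hr : 0 < r) (t : ℝ) :
    (expMeasure r).real (Set.Ioi t) = if 0 ≤ t then Real.exp (-(r * t)) else 1 := by
  have := isProbabilityMeasure_expMeasure hr
  rw [← Set.compl_Iic, probReal_compl_eq_one_sub measurableSet_Iic, ← cdf_eq_real,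
    cdf_expMeasure_eq hr]
  split_ifs <;> ring

lemma ae_expMeasure_nonneg {r : ℝ} (hr : 0 < r) : ∀ᵐ x ∂expMeasure r, 0 ≤ x := by
  have := isProbabilityMeasure_expMeasure hr
  have h := cdf_expMeasure_eq hr 0
  rw [if_pos le_rfl, mul_zero, neg_zero, Real.exp_zero, sub_self, cdf_eq_real,
    measureReal_eq_zero_iff] at h
  rw [ae_iff]
  exact measure_mono_null (fun x hx => (not_le.1 hx).le) h

variable {Ω : Type*} [MeasurableSpace Ω] {P : Measure Ω} [IsProbabilityMeasure P]

/-- The minimum of `L` independent exponential variables of parameter `r` is exponential of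
parameter `L r`. -/
lemma map_iInf_eq_expMeasure {L : ℕ} (hL : 0 < L) {x : Fin L → Ω → ℝ} {r : ℝ} (hr : 0 < r)
    (hm : ∀ l, Measurable (x l)) (hind : iIndepFun x P) (hlaw : ∀ l, P.map (x l) = expMeasure r) :
    P.map (fun ω => ⨅ l, x l ω) = expMeasure (L * r) := by
  have : Nonempty (Fin L) := ⟨⟨0, hL⟩⟩
  have hLr : 0 < L * r := by positivity
  have := isProbabilityMeasure_expMeasure hLr
  have hmi : Measurable fun ω => ⨅ l, x l ω := Measurable.iInf hm
  have := Measure.isProbabilityMeasure_map (μ := P) hmi.aemeasurable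
  refine Measure.eq_of_cdf _ _ (StieltjesFunction.ext fun t => ?_)
  have hIoi : ∀ μ : Measure ℝ, [IsProbabilityMeasure μ] → cdf μ t = 1 - μ.real (Set.Ioi t) := by
    intro μ _
    rw [cdf_eq_real, ← Set.compl_Ioi, probReal_compl_eq_one_sub measurableSet_Ioi]
  rw [hIoi, hIoi, expMeasure_real_Ioi hLr, map_measureReal_apply hmi measurableSet_Ioi]
  have hset : (fun ω => ⨅ l, x l ω) ⁻¹' Set.Ioi t = ⋂ l, x l ⁻¹' Set.Ioi t := by
    ext ω
    simp only [Set.mem_preimage, Set.mem_Ioi, Set.mem_iInter]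
    refine ⟨fun h l => h.trans_le (ciInf_le (Set.finite_range _).bddBelow l), fun h => ?_⟩
    obtain ⟨l, hl⟩ := exists_eq_ciInf_of_finite (f := fun l => x l ω)
    rw [← hl]
    exact h l
  have hprod : P.real (⋂ l, x l ⁻¹' Set.Ioi t) = ∏ l : Fin L, (expMeasure r).real (Set.Ioi t) := by
    rw [measureReal_def, hind.meas_iInter fun l => ⟨Set.Ioi t, measurableSet_Ioi, rfl⟩,
      ENNReal.toReal_prod]
    refine Finset.prod_congr rfl fun l _ => ?_
    rw [← hlaw l, map_measureReal_apply (hm l) measurableSet_Ioi, measureReal_def]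
  rw [hset, hprod, Finset.prod_const, Finset.card_univ, Fintype.card_fin, expMeasure_real_Ioi hr]
  split_ifs
  · rw [← Real.exp_nat_mul]
    ring_nf
  · simp

/-- The maximum of at most `N` exponential variables of parameter `r` has `L²`-norm
`O((log N + 1) / r)`; independence is not needed. The variable `Z` may vanish instead of being
one of the variables, which covers maxima over the empty set. -/
lemma secondMomentLE_of_exists_eq {ι : Type*} [Fintype ι] {y : ι → Ω → ℝ} {r : ℝ} (hr : 0 < r)
    (hy : ∀ i, Measurable (y i)) (hlaw : ∀ i, P.map (y i) = expMeasure r) {Z : Ω → ℝ}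
    (hm : Measurable Z) (h0 : ∀ᵐ ω ∂P, 0 ≤ Z ω) (hZ : ∀ ω, Z ω = 0 ∨ ∃ i, Z ω = y i ω) {N : ℝ}
    (hN : 1 ≤ N) (hcard : Fintype.card ι ≤ N) :
    SecondMomentLE P Z (4 / r * (Real.log (3 * N) + 1)) := by
  have hyi : ∀ i, Integrable (fun ω => Real.exp (r / 2 * y i ω)) P ∧
      ∫ ω, Real.exp (r / 2 * y i ω) ∂P = 2 := by
    intro i
    have h := integrable_exp_half_expMeasure hr
    rw [← hlaw i] at h
    have hs : AEStronglyMeasurable (fun x => Real.exp (r / 2 * x)) (P.map (y i)) :=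
      (by fun_prop : Measurable fun x => Real.exp (r / 2 * x)).aestronglyMeasurable
    exact ⟨h.1.comp_measurable (hy i), (integral_map (hy i).aemeasurable hs).symm.trans h.2⟩
  have hle : ∀ ω, Real.exp (r / 2 * Z ω) ≤ 1 + ∑ i, Real.exp (r / 2 * y i ω) := by
    intro ω
    rcases hZ ω with h | ⟨i, h⟩
    · rw [h, mul_zero, Real.exp_zero]
      exact le_add_of_nonneg_right (Finset.sum_nonneg fun i _ => (Real.exp_pos _).le)
    · rw [h]
      have := Finset.single_le_sum (f := fun i => Real.exp (r / 2 * y i ω))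
        (fun i _ => (Real.exp_pos _).le) (Finset.mem_univ i)
      linarith
  have hib : Integrable (fun ω => 1 + ∑ i, Real.exp (r / 2 * y i ω)) P :=
    (integrable_const _).add (integrable_finsetSum _ fun i _ => (hyi i).1)
  have hi : Integrable (fun ω => Real.exp (r / 2 * Z ω)) P :=
    hib.mono' (by fun_prop) <| .of_forall fun ω => by
      rw [Real.norm_of_nonneg (Real.exp_pos _).le]; exact hle ω
  have := SecondMomentLE.of_integral_exp_le hm h0 (half_pos hr) (K := 3 * N) (by linarith) hi <| by
    refine (integral_mono hi hib hle).trans ?_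
    rw [integral_add (integrable_const _) (integrable_finsetSum _ fun i _ => (hyi i).1),
      integral_finsetSum _ fun i _ => (hyi i).1]
    simp only [(hyi _).2, integral_const, probReal_univ, Finset.sum_const, Finset.card_univ,
      nsmul_eq_mul, smul_eq_mul]
    linarith
  convert this using 2
  field_simp
  norm_num

/-- The expected maximum of `m` independent exponential variables of parameter `r` is at least
`log m / (2 r)`: the probability that all of them stay below `log m / r` is
`(1 - 1 / m) ^ m ≤ 1 / e`. -/
lemma log_le_integral_of_le {m : ℕ} (hmpos : 0 < m) {y : Fin m → Ω → ℝ} {r : ℝ} (hr : 0 < r)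
    (hy : ∀ i, Measurable (y i)) (hind : iIndepFun y P) (hlaw : ∀ i, P.map (y i) = expMeasure r)
    {Z : Ω → ℝ} (hZi : Integrable Z P) (h0 : ∀ᵐ ω ∂P, 0 ≤ Z ω) (hle : ∀ᵐ ω ∂P, ∀ i, y i ω ≤ Z ω) :
    Real.log m / (2 * r) ≤ ∫ ω, Z ω ∂P := by
  set t := Real.log m / r with ht
  have hm1 : (1 : ℝ) ≤ m := by exact_mod_cast hmpos
  have ht0 : 0 ≤ t := div_nonneg (Real.log_nonneg hm1) hr.le
  have := isProbabilityMeasure_expMeasure hr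
  have hIic : (expMeasure r).real (Set.Iic t) = 1 - 1 / m := by
    rw [← cdf_eq_real, cdf_expMeasure_eq hr, if_pos ht0, ht, mul_div_cancel₀ _ hr.ne',
      Real.exp_neg, Real.exp_log (by linarith), one_div]
  have hall : P.real (⋂ i, y i ⁻¹' Set.Iic t) ≤ Real.exp (-1) := by
    rw [measureReal_def, hind.meas_iInter fun i => ⟨Set.Iic t, measurableSet_Iic, rfl⟩,
      ENNReal.toReal_prod]
    have : ∀ i, (P (y i ⁻¹' Set.Iic t)).toReal = 1 - 1 / m := fun i => by
      rw [← hIic, ← hlaw i, map_measureReal_apply (hy i) measurableSet_Iic, measureReal_def]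
    simp only [this, Finset.prod_const, Finset.card_univ, Fintype.card_fin]
    exact Real.one_sub_div_pow_le_exp_neg hm1
  have hmeas : MeasurableSet (⋂ i, y i ⁻¹' Set.Iic t) :=
    .iInter fun i => hy i measurableSet_Iic
  have hge : 1 / 2 ≤ P.real {ω | t ≤ Z ω} := by
    have h1 : P.real (⋂ i, y i ⁻¹' Set.Iic t)ᶜ ≤ P.real {ω | t ≤ Z ω} := by
      refine ENNReal.toReal_mono (measure_ne_top _ _) (measure_mono_ae ?_)
      filter_upwards [hle] with ω hω h
      have h' : ω ∉ ⋂ i, y i ⁻¹' Set.Iic t := h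
      simp only [Set.mem_iInter, Set.mem_preimage, Set.mem_Iic, not_forall, not_le] at h'
      obtain ⟨i, hi⟩ := h'
      exact hi.le.trans (hω i)
    rw [probReal_compl_eq_one_sub hmeas] at h1
    have h2 : Real.exp (-1) ≤ 1 / 2 := by
      rw [Real.exp_neg, inv_le_comm₀ (Real.exp_pos _) (by norm_num)]
      linarith [Real.add_one_le_exp (1 : ℝ)]
    linarith
  have hmarkov := mul_meas_ge_le_integral_of_nonneg h0 hZi t
  calc Real.log m / (2 * r) = t * (1 / 2) := by rw [ht]; field_simp
    _ ≤ t * P.real {ω | t ≤ Z ω} := by gcongr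
    _ ≤ _ := hmarkov

end Exponential

/-! ### The duration of a stage -/

section StageDuration

lemma turn_nonneg {G R L : ℕ} {x : ℕ → ℕ → ℕ → ℝ} (hx : ∀ g r l, 0 ≤ x g r l) :
    0 ≤ ⨆ g : Fin G, ⨆ r : Fin R, ⨅ l : Fin L, x g r l := by
  refine Real.iSup_nonneg fun g => Real.iSup_nonneg fun r => Real.iInf_nonneg fun l => ?_
  exact hx g r l

lemma stageTime_nonneg (v : Variant) (s : Stage) {x : ℕ → ℕ → ℕ → ℕ → ℝ}
    (hx : ∀ g t r l, 0 ≤ x g t r l) : 0 ≤ stageTime v s x := by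
  cases v with
  | original =>
    refine Real.iSup_nonneg fun g => Finset.sum_nonneg fun t _ =>
      Real.iSup_nonneg fun r => Real.iInf_nonneg fun l => ?_
    exact hx g t r l
  | worsened => exact Finset.sum_nonneg fun t _ =>
      turn_nonneg (x := fun g r l => x g t r l) fun g r l => hx g t r l

/-- A stage lasts no longer than it would if all groups waited for each other after every turn. -/
lemma stageTime_le (v : Variant) (s : Stage) {x : ℕ → ℕ → ℕ → ℕ → ℝ}
    (hx : ∀ g t r l, 0 ≤ x g t r l) : stageTime v s x ≤ stageTime .worsened s x := by
  cases v with
  | original =>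
    refine Real.iSup_le (fun g => Finset.sum_le_sum fun t _ => ?_) (stageTime_nonneg .worsened s hx)
    exact le_ciSup (f := fun g : Fin s.groups => ⨆ r : Fin s.targets, ⨅ l : Fin s.links, x g t r l)
      (Set.finite_range _).bddAbove g
  | worsened => exact le_rfl

/-- A stage lasts at least as long as any one of its groups is busy. -/
lemma sum_le_stageTime (v : Variant) (s : Stage) (x : ℕ → ℕ → ℕ → ℕ → ℝ) (g : Fin s.groups) :
    ∑ t : Fin s.turns, ⨆ r : Fin s.targets, ⨅ l : Fin s.links, x g t r l ≤ stageTime v s x := by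
  cases v with
  | original =>
    exact le_ciSup (f := fun g : Fin s.groups =>
      ∑ t : Fin s.turns, ⨆ r : Fin s.targets, ⨅ l : Fin s.links, x g t r l)
      (Set.finite_range _).bddAbove g
  | worsened =>
    exact Finset.sum_le_sum fun t _ => le_ciSup
      (f := fun g : Fin s.groups => ⨆ r : Fin s.targets, ⨅ l : Fin s.links, x g t r l)
      (Set.finite_range _).bddAbove g

variable {Ω : Type*} [MeasurableSpace Ω]

lemma measurable_stageTime (v : Variant) (s : Stage) {x : ℕ → ℕ → ℕ → ℕ → Ω → ℝ}
    (hx : ∀ g t r l, Measurable (x g t r l)) :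
    Measurable fun ω => stageTime v s fun g t r l => x g t r l ω := by
  cases v with
  | original =>
    exact .iSup fun _ => Finset.measurable_sum _ fun _ _ => .iSup fun _ => .iInf fun _ => hx _ _ _ _
  | worsened =>
    exact Finset.measurable_sum _ fun _ _ => .iSup fun _ => .iSup fun _ => .iInf fun _ => hx _ _ _ _

/-- The link delays of a single stage, labelled by group, turn, receiver and link: independent
exponential random variables of a common parameter `r`. -/
structure IsExpArray (P : Measure Ω) (r : ℝ) (x : ℕ → ℕ → ℕ → ℕ → Ω → ℝ) : Prop where
  measurable : ∀ g t u l, Measurable (x g t u l)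
  indep : iIndepFun (fun p : ℕ × ℕ × ℕ × ℕ => x p.1 p.2.1 p.2.2.1 p.2.2.2) P
  law : ∀ g t u l, P.map (x g t u l) = expMeasure r

variable {P : Measure Ω} {r : ℝ} {x : ℕ → ℕ → ℕ → ℕ → Ω → ℝ}

lemma IsExpArray.ae_nonneg (hx : IsExpArray P r x) (hr : 0 < r) :
    ∀ᵐ ω ∂P, ∀ g t u l, 0 ≤ x g t u l ω := by
  simp only [ae_all_iff]
  intro g t u l
  have h := ae_expMeasure_nonneg hr
  rw [← hx.law g t u l] at h
  exact ae_of_ae_map (hx.measurable g t u l).aemeasurable h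

variable [IsProbabilityMeasure P]

lemma IsExpArray.map_iInf (hx : IsExpArray P r x) (hr : 0 < r) {L : ℕ} (hL : 0 < L) (g t u : ℕ) :
    P.map (fun ω => ⨅ l : Fin L, x g t u l ω) = expMeasure (L * r) :=
  map_iInf_eq_expMeasure hL hr (fun l => hx.measurable g t u l)
    (hx.indep.precomp (g := fun l : Fin L => (g, t, u, (l : ℕ))) fun a b hab => by
      simpa [Fin.ext_iff] using hab)
    fun l => hx.law g t u l

/-- One turn, in which all groups wait for each other. -/
lemma IsExpArray.secondMomentLE_turn (hx : IsExpArray P r x) (hr : 0 < r) {G R L : ℕ}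
    (hL : 0 < L) {N : ℝ} (hN : 1 ≤ N) (hGR : (G * R : ℝ) ≤ N) (t : ℕ) :
    SecondMomentLE P (fun ω => ⨆ g : Fin G, ⨆ u : Fin R, ⨅ l : Fin L, x g t u l ω)
      (4 / (L * r) * (Real.log (3 * N) + 1)) := by
  have hmin : ∀ g u : ℕ, Measurable fun ω => ⨅ l : Fin L, x g t u l ω := fun g u =>
    .iInf fun l => hx.measurable g t u l
  refine secondMomentLE_of_exists_eq (ι := Fin G × Fin R)
    (y := fun p ω => ⨅ l : Fin L, x p.1 t p.2 l ω) (by positivity)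
    (fun p => hmin p.1 p.2) (fun p => hx.map_iInf hr hL p.1 t p.2)
    (.iSup fun g : Fin G => .iSup fun u : Fin R => hmin g u) ?_ (fun ω => ?_) hN
    (by simpa using hGR)
  · filter_upwards [hx.ae_nonneg hr] with ω h
    exact turn_nonneg (x := fun g u l => x g t u l ω) fun g u l => h g t u l
  · rcases isEmpty_or_nonempty (Fin G) with hG | hG
    · exact Or.inl (Real.iSup_of_isEmpty _)
    rcases isEmpty_or_nonempty (Fin R) with hR | hR
    · simp [Real.iSup_of_isEmpty]
    obtain ⟨g, hg⟩ := exists_eq_ciSup_of_finite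
      (f := fun g : Fin G => ⨆ u : Fin R, ⨅ l : Fin L, x g t u l ω)
    obtain ⟨u, hu⟩ := exists_eq_ciSup_of_finite (f := fun u : Fin R => ⨅ l : Fin L, x g t u l ω)
    exact Or.inr ⟨(g, u), by rw [← hg, ← hu]⟩

/-- A stage in which every turn has at most `N` receivers in all groups together, each served by
`links` links. -/
lemma IsExpArray.secondMomentLE_stageTime (hx : IsExpArray P r x) (hr : 0 < r) (v : Variant)
    (s : Stage) (hL : 0 < s.links) {N : ℝ} (hN : 1 ≤ N) (hGR : (s.groups * s.targets : ℝ) ≤ N) :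
    SecondMomentLE P (fun ω => stageTime v s fun g t u l => x g t u l ω)
      (s.turns * (4 / (s.links * r) * (Real.log (3 * N) + 1))) := by
  have hw : SecondMomentLE P (fun ω => stageTime .worsened s fun g t u l => x g t u l ω)
      (s.turns * (4 / (s.links * r) * (Real.log (3 * N) + 1))) :=
    SecondMomentLE.sum fun t : Fin s.turns => hx.secondMomentLE_turn hr hL hN hGR t
  have hlog : 0 ≤ Real.log (3 * N) := Real.log_nonneg (by linarith)
  refine hw.mono (measurable_stageTime v s hx.measurable) ?_ ?_ (by positivity) le_rfl
  · filter_upwards [hx.ae_nonneg hr] with ω h using stageTime_nonneg v s h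
  · filter_upwards [hx.ae_nonneg hr] with ω h using stageTime_le v s h

/-- A stage of time division, in which every turn serves `targets` receivers over one link each,
lasts `turns * log targets / (2 r)` at least, on average. -/
lemma IsExpArray.le_integral_stageTime (hx : IsExpArray P r x) (hr : 0 < r) (v : Variant)
    (s : Stage) (hL : s.links = 1) (hG : 0 < s.groups) (hR : 0 < s.targets) :
    s.turns * (Real.log s.targets / (2 * r))
      ≤ ∫ ω, stageTime v s (fun g t u l => x g t u l ω) ∂P := by
  have hturn : ∀ t : ℕ, SecondMomentLE P
      (fun ω => ⨆ g : Fin 1, ⨆ u : Fin s.targets, ⨅ l : Fin s.links, x g t u l ω)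
      (4 / (s.links * r) * (Real.log (3 * s.targets) + 1)) := fun t =>
    hx.secondMomentLE_turn hr (by omega) (by exact_mod_cast hR) (by simp) t
  simp only [ciSup_unique, Fin.default_eq_zero, Fin.val_zero] at hturn
  have hstage : Integrable (fun ω => stageTime v s fun g t u l => x g t u l ω) P :=
    (hx.secondMomentLE_stageTime hr v s (by omega) (le_max_right _ _)
      (le_max_left _ 1)).memLp.integrable one_le_two
  have hone : ∀ t : ℕ, Real.log s.targets / (2 * r)
      ≤ ∫ ω, ⨆ u : Fin s.targets, ⨅ l : Fin s.links, x 0 t u l ω ∂P := by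
    intro t
    refine log_le_integral_of_le hR (y := fun u ω => x 0 t u 0 ω) hr
      (fun u => hx.measurable 0 t u 0)
      (hx.indep.precomp (g := fun u : Fin s.targets => (0, t, (u : ℕ), 0)) fun a b hab => by
        simpa [Fin.ext_iff] using hab)
      (fun u => hx.law 0 t u 0) ((hturn t).memLp.integrable one_le_two) (hturn t).nonneg
      (.of_forall fun ω u => ?_)
    refine le_trans (le_of_eq ?_) (le_ciSup (f := fun u : Fin s.targets =>
      ⨅ l : Fin s.links, x 0 t u l ω) (Set.finite_range _).bddAbove u)
    rw [hL, ciInf_unique]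
    rfl
  calc s.turns * (Real.log s.targets / (2 * r))
      = ∑ _t : Fin s.turns, Real.log s.targets / (2 * r) := by simp
    _ ≤ ∑ t : Fin s.turns, ∫ ω, ⨆ u : Fin s.targets, ⨅ l : Fin s.links, x 0 t u l ω ∂P :=
      Finset.sum_le_sum fun t _ => hone t
    _ = ∫ ω, ∑ t : Fin s.turns, ⨆ u : Fin s.targets, ⨅ l : Fin s.links, x 0 t u l ω ∂P :=
      (integral_finsetSum _ fun (t : Fin s.turns) _ =>
        (hturn t).memLp.integrable one_le_two).symm
    _ ≤ _ := integral_mono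
      (integrable_finsetSum _ fun t _ => (hturn t).memLp.integrable one_le_two) hstage
      fun ω => sum_le_stageTime v s (fun g t u l => x g t u l ω) ⟨0, hG⟩

end StageDuration

/-! ### The stages of a session -/

section Stages

/-- The properties of the stages used in the bound on the session time: at most `N` receivers in
a turn, and at most `κ` turns for each link that serves a receiver. -/
structure Stage.Bounded (s : Stage) (level : ℕ) (N κ : ℝ) : Prop where
  level_le : s.level ≤ level
  links_pos : 0 < s.links
  receivers_le : (s.groups * s.targets : ℝ) ≤ N
  turns_le : (s.turns : ℝ) ≤ κ * s.links

lemma Variant.others_le (v : Variant) (m : ℕ) : v.others m ≤ m := by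
  cases v
  · exact Nat.sub_le m 1
  · exact le_rfl

/-- The transmissions between subgroups: `s` turns and `s ^ 2` links for each receiver. -/
lemma bounded_between {q d g ℓ m : ℕ} (hq : 0 < q) (hm : m ≤ q ^ 2 ^ d) :
    (Stage.mk ℓ g (q ^ 2 ^ d) m ((q ^ 2 ^ d) ^ 2)).Bounded (ℓ + (d + 1))
      (g * q ^ 2 ^ (d + 1)) q := by
  have hs : (1 : ℝ) ≤ (q : ℝ) ^ 2 ^ d := one_le_pow₀ (by exact_mod_cast hq)
  have hq1 : (1 : ℝ) ≤ q := by exact_mod_cast hq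
  have hm' : (m : ℝ) ≤ (q : ℝ) ^ 2 ^ d := by exact_mod_cast hm
  refine ⟨by simp, by positivity, ?_, ?_⟩
  · simp only
    rw [pow_succ 2 d, pow_mul]
    gcongr
    nlinarith
  · push_cast
    have h2 : (q : ℝ) ^ 2 ^ d ≤ ((q : ℝ) ^ 2 ^ d) ^ 2 := le_self_pow₀ hs two_ne_zero
    exact h2.trans (le_mul_of_one_le_left (by positivity) hq1)

lemma bounded_of_mem_allToAll (v : Variant) {q : ℕ} (hq : 0 < q) {s : Stage} :
    ∀ {d g ℓ k : ℕ}, k ≤ q → s ∈ allToAll v q d g ℓ k →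
      s.Bounded (ℓ + d) (g * q ^ 2 ^ d) q := by
  intro d
  induction d with
  | zero =>
    intro g ℓ k hk hs
    simp only [allToAll, List.mem_singleton] at hs
    subst hs
    refine ⟨le_rfl, one_pos, ?_, by simpa using hk⟩
    have : (v.others q : ℝ) ≤ q := by exact_mod_cast v.others_le q
    simp only [pow_zero, pow_one]
    gcongr
  | succ d ih =>
    intro g ℓ k hk hs
    have hsub : ∀ k ≤ q, s ∈ allToAll v q d (g * q ^ 2 ^ d) (ℓ + 1) k →
        s.Bounded (ℓ + (d + 1)) (g * q ^ 2 ^ (d + 1)) q := by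
      intro k hk hs
      obtain ⟨h1, h2, h3, h4⟩ := ih hk hs
      refine ⟨by omega, h2, h3.trans_eq ?_, h4⟩
      push_cast
      rw [pow_succ 2 d, pow_mul]
      ring
    simp only [allToAll, List.mem_append, List.mem_singleton] at hs
    rcases hs with (hs | rfl) | hs
    · exact hsub q le_rfl hs
    · exact bounded_between hq (v.others_le _)
    · exact hsub _ (v.others_le q) hs

lemma bounded_of_mem_relay (v : Variant) {q : ℕ} (hq : 0 < q) {s : Stage} :
    ∀ {d g ℓ : ℕ}, s ∈ relay v q d g ℓ → s.Bounded (ℓ + d) (g * q ^ 2 ^ d) q := by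
  intro d
  induction d with
  | zero =>
    intro g ℓ hs
    simp only [relay, List.mem_singleton] at hs
    subst hs
    have : (1 : ℝ) ≤ q := by exact_mod_cast hq
    refine ⟨le_rfl, one_pos, ?_, by simp⟩
    simp only [pow_zero, pow_one, Nat.cast_one]
    gcongr
  | succ d ih =>
    intro g ℓ hs
    have hsub : s.Bounded (ℓ + 1 + d) ((g * q ^ 2 ^ d : ℕ) * q ^ 2 ^ d) q →
        s.Bounded (ℓ + (d + 1)) (g * q ^ 2 ^ (d + 1)) q := by
      rintro ⟨h1, h2, h3, h4⟩
      refine ⟨by omega, h2, h3.trans_eq ?_, h4⟩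
      push_cast
      rw [pow_succ 2 d, pow_mul]
      ring
    simp only [relay, List.mem_append, List.mem_singleton] at hs
    rcases hs with (hs | rfl) | hs
    · exact hsub (bounded_of_mem_allToAll v hq le_rfl hs)
    · exact bounded_between hq le_rfl
    · exact hsub (ih hs)

lemma bounded_of_mem_stages (v : Variant) {h q c : ℕ} (hq : 0 < q) (hc : 0 < c) {κ : ℝ}
    (hqκ : q ≤ κ) (hcκ : c ≤ κ * (q ^ 2 ^ h) ^ 2) {s : Stage} (hs : s ∈ stages v h q c) :
    s.Bounded (h + 1) (c * q ^ 2 ^ h) κ := by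
  have hsub : s.Bounded (1 + h) (c * q ^ 2 ^ h) q → s.Bounded (h + 1) (c * q ^ 2 ^ h) κ :=
    fun ⟨h1, h2, h3, h4⟩ => ⟨by omega, h2, h3, h4.trans (by gcongr)⟩
  simp only [stages, List.mem_append, List.mem_singleton] at hs
  rcases hs with (hs | rfl) | hs
  · exact hsub (bounded_of_mem_allToAll v hq le_rfl hs)
  · refine ⟨by simp, by positivity, ?_, by push_cast; exact hcκ⟩
    have : (1 : ℝ) ≤ c := by exact_mod_cast hc
    push_cast
    gcongr
  · exact hsub (bounded_of_mem_relay v hq hs)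

lemma exists_length_stages_le (h : ℕ) :
    ∃ K : ℕ, ∀ v q c, (stages v h q c).length ≤ K := by
  have hA : ∀ d, ∃ K : ℕ, ∀ v q g ℓ k, (allToAll v q d g ℓ k).length ≤ K := by
    intro d
    induction d with
    | zero => exact ⟨1, fun _ _ _ _ _ => le_rfl⟩
    | succ d ih =>
      obtain ⟨K, hK⟩ := ih
      refine ⟨K + 1 + K, fun v q g ℓ k => ?_⟩
      simp only [allToAll, List.length_append, List.length_singleton]
      gcongr <;> apply hK
  have hB : ∀ d, ∃ K : ℕ, ∀ v q g ℓ, (relay v q d g ℓ).length ≤ K := by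
    intro d
    induction d with
    | zero => exact ⟨1, fun _ _ _ _ => le_rfl⟩
    | succ d ih =>
      obtain ⟨K, hK⟩ := ih
      obtain ⟨K', hK'⟩ := hA d
      refine ⟨K' + 1 + K, fun v q g ℓ => ?_⟩
      simp only [relay, List.length_append, List.length_singleton]
      gcongr
      · apply hK'
      · apply hK
  obtain ⟨K, hK⟩ := hA h
  obtain ⟨K', hK'⟩ := hB h
  refine ⟨K + 1 + K', fun v q c => ?_⟩
  simp only [stages, List.length_append, List.length_singleton]
  gcongr
  · apply hK
  · apply hK'

/-- A session contains a full exchange by time division in the smallest groups. -/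
lemma exists_mem_stages (v : Variant) (h : ℕ) {q c : ℕ} (hq : 0 < q) (hc : 0 < c) :
    ∃ g, 0 < g ∧ Stage.mk (h + 1) g q (v.others q) 1 ∈ stages v h q c := by
  have hA : ∀ d g ℓ, 0 < g →
      ∃ g', 0 < g' ∧ Stage.mk (ℓ + d) g' q (v.others q) 1 ∈ allToAll v q d g ℓ q := by
    intro d
    induction d with
    | zero => exact fun g ℓ hg => ⟨g, hg, List.mem_singleton_self _⟩
    | succ d ih =>
      intro g ℓ hg
      obtain ⟨g', hg', hmem⟩ := ih (g * q ^ 2 ^ d) (ℓ + 1) (by positivity)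
      refine ⟨g', hg', ?_⟩
      rw [add_assoc, add_comm 1 d] at hmem
      simp only [allToAll, List.mem_append]
      exact Or.inl (Or.inl hmem)
  obtain ⟨g, hg, hmem⟩ := hA h c 1 hc
  rw [add_comm 1 h] at hmem
  exact ⟨g, hg, by simp only [stages, List.mem_append]; exact Or.inl (Or.inl hmem)⟩

end Stages

/-! ### The law of the session time -/

section Session

/-- The label of a use of a link within a session, together with the type of the link: type,
stage, group, turn, receiver and link. -/
abbrev Label : Type := ℕ × ℕ × ℕ × ℕ × ℕ × ℕ

/-- The delays in session `k`, of all links in all their uses. -/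
def sessionDelays (X : ℕ → Transmission → ℝ) (k : ℕ) : Label → ℝ := fun p =>
  X p.1 ⟨k, p.2.1, p.2.2.1, p.2.2.2.1, p.2.2.2.2.1, p.2.2.2.2.2⟩

/-- The duration of a session as a function of the delays in it. -/
noncomputable def duration (v : Variant) (h q c : ℕ) (z : Label → ℝ) : ℝ :=
  ∑ i : Fin (stages v h q c).length,
    stageTime v ((stages v h q c).get i)
      fun g t r l => z (((stages v h q c).get i).level, i, g, t, r, l)

/-- The joint law of the delays in a session. -/
noncomputable def delayLaw (lam : ℕ → ℝ) : Measure (Label → ℝ) :=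
  Measure.infinitePi fun p => expMeasure (lam p.1)

variable {lam : ℕ → ℝ}

lemma isProbabilityMeasure_delayLaw (hlam : ∀ j, 0 < lam j) :
    IsProbabilityMeasure (delayLaw lam) := by
  have (p : Label) := isProbabilityMeasure_expMeasure (hlam p.1)
  unfold delayLaw
  infer_instance

lemma isExpArray_delayLaw (hlam : ∀ j, 0 < lam j) (j i : ℕ) :
    IsExpArray (delayLaw lam) (lam j) fun g t u l (z : Label → ℝ) => z (j, i, g, t, u, l) := by
  have (p : Label) := isProbabilityMeasure_expMeasure (hlam p.1)
  refine ⟨fun g t u l => by fun_prop, ?_, fun g t u l => Measure.infinitePi_map_eval _ _⟩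
  have h : iIndepFun (fun (p : Label) (z : Label → ℝ) => z p) (delayLaw lam) :=
    iIndepFun_infinitePi (X := fun _ x => x) fun _ => measurable_id
  exact h.precomp (g := fun p : ℕ × ℕ × ℕ × ℕ => (j, i, p.1, p.2.1, p.2.2.1, p.2.2.2))
    fun a b hab => by simpa [Prod.ext_iff] using hab

lemma measurable_duration (v : Variant) (h q c : ℕ) : Measurable (duration v h q c) :=
  Finset.measurable_sum _ fun i _ => measurable_stageTime v _
    (x := fun g t u l (z : Label → ℝ) => z (((stages v h q c).get i).level, i, g, t, u, l))
    fun g t u l => by fun_prop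

section Delays

variable {Ω : Type*} [MeasurableSpace Ω] {P : Measure Ω} {X : ℕ → Transmission → Ω → ℝ}

lemma IsDelayFamily.measurable_sessionDelays (hX : IsDelayFamily P lam X) (k : ℕ) :
    Measurable fun ω => sessionDelays (fun j i => X j i ω) k :=
  measurable_pi_lambda _ fun _ => hX.measurable _ _

lemma IsDelayFamily.map_sessionDelays (hX : IsDelayFamily P lam X) (k : ℕ) :
    P.map (fun ω => sessionDelays (fun j i => X j i ω) k) = delayLaw lam := by
  have h := hX.indep.precomp (g := fun p : Label =>
    (p.1, Transmission.mk k p.2.1 p.2.2.1 p.2.2.2.1 p.2.2.2.2.1 p.2.2.2.2.2)) fun a b hab => by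
      simpa [Prod.ext_iff] using hab
  have h' := h.map_fun_eq_infinitePi_map fun p => hX.measurable _ _
  simp only [hX.law] at h'
  exact h'

/-- The delays in different sessions are independent. -/
lemma IsDelayFamily.iIndepFun_sessionDelays [IsProbabilityMeasure P] (hX : IsDelayFamily P lam X)
    (hlam : ∀ j, 0 < lam j) :
    iIndepFun (fun k ω => sessionDelays (fun j i => X j i ω) k) P := by
  have (p : Label) : IsProbabilityMeasure (expMeasure (lam p.1)) :=
    isProbabilityMeasure_expMeasure (hlam p.1)
  rw [iIndepFun_iff_map_fun_eq_infinitePi_map hX.measurable_sessionDelays]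
  simp only [hX.map_sessionDelays]
  -- The joint law of all delays is a product over pairs of a session and a label; curried, it is
  -- the product over the sessions.
  have h := hX.indep.precomp (g := fun p : ℕ × Label => (p.2.1, Transmission.mk p.1 p.2.2.1
    p.2.2.2.1 p.2.2.2.2.1 p.2.2.2.2.2.1 p.2.2.2.2.2.2)) fun a b hab => by
      simp only [Prod.mk.injEq, Transmission.mk.injEq] at hab
      simp only [Prod.ext_iff]
      tauto
  have h' := h.map_fun_eq_infinitePi_map fun p => hX.measurable _ _
  simp only [hX.law] at h'
  have hcurry := Measure.infinitePi_map_curry fun (_ : ℕ) (p : Label) => expMeasure (lam p.1)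
  rw [← h', Measure.map_map (MeasurableEquiv.measurable _)
    (measurable_pi_lambda _ fun p => hX.measurable _ _)] at hcurry
  exact hcurry

end Delays

lemma ae_duration_nonneg (hlam : ∀ j, 0 < lam j) (v : Variant) (h q c : ℕ) :
    ∀ᵐ z ∂delayLaw lam, 0 ≤ duration v h q c z := by
  have := fun i : Fin (stages v h q c).length =>
    (isExpArray_delayLaw hlam ((stages v h q c).get i).level i).ae_nonneg (hlam _)
  filter_upwards [ae_all_iff.2 this] with z hz
  exact Finset.sum_nonneg fun i _ => stageTime_nonneg v _ (hz i)

lemma secondMomentLE_duration (hlam : ∀ j, 0 < lam j) (v : Variant) {h q c K : ℕ} {N κ r : ℝ}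
    (hN : 1 ≤ N) (hκ : 0 ≤ κ) (hr : 0 < r) (hrlam : ∀ j ≤ h + 1, r ≤ lam j)
    (hs : ∀ s ∈ stages v h q c, s.Bounded (h + 1) N κ) (hK : (stages v h q c).length ≤ K) :
    SecondMomentLE (delayLaw lam) (duration v h q c)
      (K * (κ * (4 / r * (Real.log (3 * N) + 1)))) := by
  have := isProbabilityMeasure_delayLaw hlam
  have hlog : 0 ≤ Real.log (3 * N) := Real.log_nonneg (by linarith)
  have hsum := SecondMomentLE.sum (P := delayLaw lam) (B := κ * (4 / r * (Real.log (3 * N) + 1)))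
    (Z := fun (i : Fin (stages v h q c).length) z => stageTime v ((stages v h q c).get i)
      fun g t u l => z (((stages v h q c).get i).level, i, g, t, u, l)) fun i => by
    obtain ⟨h1, h2, h3, h4⟩ := hs _ ((stages v h q c).get_mem i)
    have hL : (0 : ℝ) < ((stages v h q c).get i).links := by exact_mod_cast h2
    have hi := (isExpArray_delayLaw hlam ((stages v h q c).get i).level i).secondMomentLE_stageTime
      (hlam _) v _ h2 hN h3
    have hl := hlam ((stages v h q c).get i).level
    refine hi.mono hi.measurable hi.nonneg (.of_forall fun _ => le_rfl) (by positivity) ?_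
    calc _ ≤ κ * ((stages v h q c).get i).links * (4 / (((stages v h q c).get i).links *
          lam ((stages v h q c).get i).level) * (Real.log (3 * N) + 1)) := by
          gcongr
      _ = κ * (4 / lam ((stages v h q c).get i).level * (Real.log (3 * N) + 1)) := by
        field_simp
      _ ≤ _ := by
        gcongr
        exact hrlam _ h1
  exact hsum.mono (measurable_duration v h q c) hsum.nonneg (.of_forall fun _ => le_rfl)
    (by positivity) (by gcongr)

lemma le_integral_duration (hlam : ∀ j, 0 < lam j) (v : Variant) {h q c : ℕ} (hq : 2 ≤ q)
    (hc : 0 < c) (hint : Integrable (duration v h q c) (delayLaw lam)) :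
    q * (Real.log (v.others q) / (2 * lam (h + 1))) ≤ ∫ z, duration v h q c z ∂delayLaw lam := by
  have := isProbabilityMeasure_delayLaw hlam
  obtain ⟨g, hg, hmem⟩ := exists_mem_stages v h (by omega : 0 < q) hc
  obtain ⟨i, hi⟩ := List.get_of_mem hmem
  have hpos : 0 < v.others q := by
    cases v
    · exact Nat.sub_pos_of_lt hq
    · exact (by omega : 0 < q)
  have hA := isExpArray_delayLaw hlam (h + 1) i
  refine (hA.le_integral_stageTime (hlam _) v (Stage.mk (h + 1) g q (v.others q) 1) rfl hg
    hpos).trans ?_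
  refine integral_mono_ae ((hA.secondMomentLE_stageTime (hlam _) v _ one_pos (le_max_right _ _)
    (le_max_left _ 1)).memLp.integrable one_le_two) hint ?_
  have hnn := fun i : Fin (stages v h q c).length =>
    (isExpArray_delayLaw hlam ((stages v h q c).get i).level i).ae_nonneg (hlam _)
  filter_upwards [ae_all_iff.2 hnn] with z hz
  have := Finset.single_le_sum (f := fun i : Fin (stages v h q c).length =>
    stageTime v ((stages v h q c).get i)
      fun g t r l => z (((stages v h q c).get i).level, i, g, t, r, l))
    (fun i _ => stageTime_nonneg v _ (hz i)) (Finset.mem_univ i)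
  simp only [hi] at this
  exact this

/-- The average age, as a function of the first two moments of the session time. -/
noncomputable def averageAge (lam : ℕ → ℝ) (v : Variant) (h q c : ℕ) : ℝ :=
  (∫ z, duration v h q c z ∂delayLaw lam) + (∫ z, duration v h q c z ^ 2 ∂delayLaw lam) /
    (2 * ∫ z, duration v h q c z ∂delayLaw lam)

lemma ae_hasAverageAge_sessionTime (hlam : ∀ j, 0 < lam j) (v : Variant) {h q c : ℕ}
    (hL : MemLp (duration v h q c) 2 (delayLaw lam))
    (hpos : 0 < ∫ z, duration v h q c z ∂delayLaw lam)
    {Ω : Type*} [MeasurableSpace Ω] {P : Measure Ω} [IsProbabilityMeasure P]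
    {X : ℕ → Transmission → Ω → ℝ} (hX : IsDelayFamily P lam X) :
    ∀ᵐ ω ∂P, HasAverageAge (sessionTime v h q c fun j i => X j i ω) (averageAge lam v h q c) := by
  have hd := measurable_duration v h q c
  have hm := hX.measurable_sessionDelays
  have hmp : ∀ k, MeasurePreserving (fun ω => sessionDelays (fun j i => X j i ω) k) P
    (delayLaw lam) := fun k => ⟨hm k, hX.map_sessionDelays k⟩
  have hid : ∀ k, IdentDistrib (fun ω => sessionDelays (fun j i => X j i ω) k)
      (fun ω => sessionDelays (fun j i => X j i ω) 0) P P := fun k =>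
    ⟨(hm k).aemeasurable, (hm 0).aemeasurable, by
      rw [hX.map_sessionDelays, hX.map_sessionDelays]⟩
  have hi : ∀ f : ℝ → ℝ, Measurable f →
      ∫ ω, f (duration v h q c (sessionDelays (fun j i => X j i ω) 0)) ∂P
        = ∫ z, f (duration v h q c z) ∂delayLaw lam := fun f hf => by
    rw [← hX.map_sessionDelays 0]
    exact (integral_map (hm 0).aemeasurable (hf.comp hd).aestronglyMeasurable).symm
  have h1 := hi id measurable_id
  have h2 := hi (fun x => x ^ 2) (measurable_id.pow_const 2)
  simp only [id] at h1
  have h := ae_hasAverageAge (P := P)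
    (Y := fun k ω => duration v h q c (sessionDelays (fun j i => X j i ω) k))
    (fun k => hd.comp (hm k))
    ((hX.iIndepFun_sessionDelays hlam).comp (fun _ => duration v h q c) fun _ => hd)
    (fun k => (hid k).comp (u := duration v h q c) hd)
    (hL.comp_measurePreserving (hmp 0))
    (ae_all_iff.2 fun k => (hmp k).quasiMeasurePreserving.ae (ae_duration_nonneg hlam v h q c))
    (by rw [h1]; exact hpos)
  rw [h1, h2] at h
  exact h

end Session

/-! ### Asymptotics -/

section Asymptotics

lemma ageExponent_pos (h : ℕ) : 0 < ageExponent h := by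
  unfold ageExponent
  positivity

lemma one_sub_eq (h : ℕ) :
    1 - 2 ^ h * ageExponent h = ageExponent h + 2 * (2 ^ h * ageExponent h) := by
  unfold ageExponent
  field_simp
  ring

lemma tendsto_ageExponent : Tendsto ageExponent atTop (𝓝 0) := by
  unfold ageExponent
  refine tendsto_const_nhds.div_atTop (tendsto_atTop_add_const_right _ _ ?_)
  exact (tendsto_pow_atTop_atTop_of_one_lt one_lt_two).const_mul_atTop three_pos

lemma SecondMomentLE.integral_le {Ω : Type*} [MeasurableSpace Ω] {P : Measure Ω}
    [IsProbabilityMeasure P] {Z : Ω → ℝ} {B : ℝ} (hZ : SecondMomentLE P Z B) (hB : 0 ≤ B) :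
    ∫ ω, Z ω ∂P ≤ B := by
  have h := variance_nonneg Z P
  rw [variance_eq_sub hZ.memLp] at h
  have h2 := hZ.integral_sq_le
  refine le_of_sq_le_sq ?_ hB
  simp only [Pi.pow_apply] at h
  linarith

/-- The average age is of the order of the `L²`-norm of the session time, once the mean of the
session time is of the same order. -/
lemma averageAge_bounds {lam : ℕ → ℝ} (hlam : ∀ j, 0 < lam j) {v : Variant} {h q c : ℕ} {a b y : ℝ}
    (ha : 0 ≤ a) (hb : 0 < b) (hy : 0 < y)
    (hup : SecondMomentLE (delayLaw lam) (duration v h q c) (a * y))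
    (hlow : b * y ≤ ∫ z, duration v h q c z ∂delayLaw lam) :
    ‖averageAge lam v h q c‖ ≤ (a + a ^ 2 / (2 * b)) * y := by
  have := isProbabilityMeasure_delayLaw hlam
  have hay : 0 ≤ a * y := by positivity
  have h1 := hup.integral_le hay
  have h2 := hup.integral_sq_le
  have h0 : 0 ≤ ∫ z, duration v h q c z ^ 2 ∂delayLaw lam := integral_nonneg fun z => sq_nonneg _
  have hbm : 0 < b * y := by positivity
  have hm : 0 < ∫ z, duration v h q c z ∂delayLaw lam := hbm.trans_le hlow
  unfold averageAge
  rw [Real.norm_of_nonneg (by positivity)]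
  calc _ ≤ a * y + (a * y) ^ 2 / (2 * (b * y)) := by gcongr
    _ = _ := by field_simp

/-- The parameters of the network of size `n`: the turns of the smallest groups and of the cells
are `O(n ^ α)` per link, the logarithm of the number of nodes is `O(log n)`, and the smallest groups
have at least `D n ^ α` nodes, of which every node has at least `n ^ (α / 2)` others to reach. -/
lemma exists_network_bounds (h : ℕ) {q c : ℕ → ℕ}
    (hq : (fun n => (q n : ℝ)) =Θ[atTop] fun n => (n : ℝ) ^ ageExponent h)
    (hc : (fun n => (c n : ℝ)) =Θ[atTop] fun n => (n : ℝ) ^ (1 - 2 ^ h * ageExponent h)) :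
    ∃ C D : ℝ, 0 < C ∧ 0 < D ∧ ∀ᶠ n : ℕ in atTop, 2 ≤ q n ∧ 0 < c n ∧
      q n ≤ C * (n : ℝ) ^ ageExponent h ∧
      c n ≤ C * (n : ℝ) ^ ageExponent h * ((q n : ℝ) ^ 2 ^ h) ^ 2 ∧
      Real.log (3 * (c n * (q n : ℝ) ^ 2 ^ h)) + 1 ≤ 2 * Real.log n ∧
      D * (n : ℝ) ^ ageExponent h ≤ q n ∧
      ageExponent h / 2 * Real.log n ≤ Real.log (q n - 1 : ℝ) := by
  set α := ageExponent h with hα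
  have hα0 : 0 < α := ageExponent_pos h
  obtain ⟨C₁, hC₁, hq₁⟩ := hq.1.exists_pos
  obtain ⟨C₂, hC₂, hq₂⟩ := hq.2.exists_pos
  obtain ⟨C₃, hC₃, hc₁⟩ := hc.1.exists_pos
  obtain ⟨C₄, hC₄, hc₂⟩ := hc.2.exists_pos
  have hpow : Tendsto (fun n : ℕ => (n : ℝ) ^ (α / 2)) atTop atTop :=
    (tendsto_rpow_atTop (half_pos hα0)).comp tendsto_natCast_atTop_atTop
  refine ⟨C₁ + C₃ * (C₂ ^ 2 ^ h) ^ 2, C₂⁻¹, by positivity, by positivity, ?_⟩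
  filter_upwards [hq₁.bound, hq₂.bound, hc₁.bound, hc₂.bound, eventually_ge_atTop 1,
    hpow.eventually_ge_atTop (2 * C₂ + 1),
    tendsto_natCast_atTop_atTop.eventually_ge_atTop (3 * (C₃ * C₁ ^ 2 ^ h) * Real.exp 1)]
    with n b1 b2 b3 b4 hn1 hp hbig
  have hn : (0 : ℝ) < n := by exact_mod_cast hn1
  have hx : 0 < (n : ℝ) ^ α := Real.rpow_pos_of_pos hn _
  have hy : 0 < (n : ℝ) ^ (1 - 2 ^ h * α) := Real.rpow_pos_of_pos hn _
  simp only [Real.norm_of_nonneg hx.le, Real.norm_of_nonneg hy.le, Real.norm_natCast] at b1 b2 b3 b4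
  have hhalf : (n : ℝ) ^ α = (n : ℝ) ^ (α / 2) * (n : ℝ) ^ (α / 2) := by
    rw [← Real.rpow_add hn, add_halves]
  set w := (n : ℝ) ^ (α / 2) with hw
  -- Half of the exponent absorbs the implied constant: `q n ≥ w ^ 2 / C₂ ≥ 2 w`.
  have hqlow : 2 * w ≤ q n := by
    have : C₂ * (2 * w) ≤ C₂ * q n := by
      rw [hhalf] at b2
      nlinarith
    exact le_of_mul_le_mul_left this hC₂
  have hw1 : 1 ≤ w := by linarith
  have hq2 : (2 : ℝ) ≤ q n := by linarith
  have hc0 : (0 : ℝ) < c n := by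
    by_contra hneg
    nlinarith
  have hM : ((n : ℝ) ^ α) ^ 2 ^ h = (n : ℝ) ^ (2 ^ h * α) := by
    rw [← Real.rpow_natCast, ← Real.rpow_mul hn.le, mul_comm]
    norm_num
  have hMlow : (n : ℝ) ^ (2 ^ h * α) ≤ C₂ ^ 2 ^ h * (q n : ℝ) ^ 2 ^ h := by
    rw [← hM, ← mul_pow]
    gcongr
  have hMup : (q n : ℝ) ^ 2 ^ h ≤ C₁ ^ 2 ^ h * (n : ℝ) ^ (2 ^ h * α) := by
    rw [← hM, ← mul_pow]
    gcongr
  -- The choice of `α` balances phase II: `1 - b = α + 2 b`, so that `c n / M ^ 2 = O(n ^ α)`.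
  have hsplit : (n : ℝ) ^ (1 - 2 ^ h * α) = (n : ℝ) ^ α * ((n : ℝ) ^ (2 ^ h * α)) ^ 2 := by
    rw [hα, one_sub_eq, ← hα, Real.rpow_add hn, two_mul, Real.rpow_add hn, sq]
  refine ⟨by exact_mod_cast hq2, by exact_mod_cast hc0, ?_, ?_, ?_, ?_, ?_⟩
  · exact b1.trans (by gcongr; exact le_add_of_nonneg_right (by positivity))
  · calc (c n : ℝ) ≤ C₃ * ((n : ℝ) ^ α * ((n : ℝ) ^ (2 ^ h * α)) ^ 2) := by rwa [← hsplit]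
      _ ≤ C₃ * ((n : ℝ) ^ α * (C₂ ^ 2 ^ h * (q n : ℝ) ^ 2 ^ h) ^ 2) := by gcongr
      _ = C₃ * (C₂ ^ 2 ^ h) ^ 2 * (n : ℝ) ^ α * ((q n : ℝ) ^ 2 ^ h) ^ 2 := by ring
      _ ≤ _ := by gcongr; exact le_add_of_nonneg_left hC₁.le
  · have hN : (c n : ℝ) * (q n : ℝ) ^ 2 ^ h ≤ C₃ * C₁ ^ 2 ^ h * n := by
      calc (c n : ℝ) * (q n : ℝ) ^ 2 ^ h
          ≤ C₃ * (n : ℝ) ^ (1 - 2 ^ h * α) * (C₁ ^ 2 ^ h * (n : ℝ) ^ (2 ^ h * α)) := by gcongr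
        _ = C₃ * C₁ ^ 2 ^ h * ((n : ℝ) ^ (1 - 2 ^ h * α) * (n : ℝ) ^ (2 ^ h * α)) := by ring
        _ = _ := by rw [← Real.rpow_add hn, sub_add_cancel, Real.rpow_one]
    have hq0 : (0 : ℝ) < q n := by linarith
    have hNpos : 0 < 3 * ((c n : ℝ) * (q n : ℝ) ^ 2 ^ h) := by positivity
    calc Real.log (3 * (c n * (q n : ℝ) ^ 2 ^ h)) + 1
        = Real.log (3 * (c n * (q n : ℝ) ^ 2 ^ h) * Real.exp 1) := by
          rw [Real.log_mul hNpos.ne' (Real.exp_pos _).ne', Real.log_exp]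
      _ ≤ Real.log ((n : ℝ) ^ 2) := by
        refine Real.log_le_log (by positivity) ?_
        calc 3 * (c n * (q n : ℝ) ^ 2 ^ h) * Real.exp 1
            ≤ 3 * (C₃ * C₁ ^ 2 ^ h * n) * Real.exp 1 := by gcongr
          _ = 3 * (C₃ * C₁ ^ 2 ^ h) * Real.exp 1 * n := by ring
          _ ≤ n * n := by gcongr
          _ = _ := (sq _).symm
      _ = 2 * Real.log n := by rw [Real.log_pow]; norm_num
  · rwa [inv_mul_le_iff₀ hC₂]
  · rw [← Real.log_rpow hn, ← hw]
    exact Real.log_le_log (by linarith) (by linarith)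

lemma Variant.le_others (v : Variant) {m : ℕ} (hm : 1 ≤ m) : (m : ℝ) - 1 ≤ v.others m := by
  cases v
  · simp [Variant.others, Nat.cast_sub hm]
  · simp [Variant.others]

/-- The session time has mean of order `n ^ α log n` at least, and `L²`-norm of the same order at
most. -/
lemma exists_duration_bounds (h : ℕ) {lam : ℕ → ℝ} (hlam : ∀ j, 0 < lam j) {q c : ℕ → ℕ}
    (hq : (fun n => (q n : ℝ)) =Θ[atTop] fun n => (n : ℝ) ^ ageExponent h)
    (hc : (fun n => (c n : ℝ)) =Θ[atTop] fun n => (n : ℝ) ^ (1 - 2 ^ h * ageExponent h))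
    (v : Variant) :
    ∃ a b : ℝ, 0 ≤ a ∧ 0 < b ∧ ∀ᶠ n : ℕ in atTop,
      SecondMomentLE (delayLaw lam) (duration v h (q n) (c n))
        (a * ((n : ℝ) ^ ageExponent h * Real.log n)) ∧
      b * ((n : ℝ) ^ ageExponent h * Real.log n)
        ≤ ∫ z, duration v h (q n) (c n) z ∂delayLaw lam := by
  have := isProbabilityMeasure_delayLaw hlam
  obtain ⟨C, D, hC, hD, hCD⟩ := exists_network_bounds h hq hc
  obtain ⟨K, hK⟩ := exists_length_stages_le h
  obtain ⟨j₀, -, hj₀⟩ := (Finset.range (h + 2)).exists_min_image lam ⟨0, by simp⟩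
  have hα := ageExponent_pos h
  have hl := hlam (h + 1)
  have hr := hlam j₀
  refine ⟨K * (C * (4 / lam j₀ * 2)), D * (ageExponent h / 2 / (2 * lam (h + 1))),
    by positivity, by positivity, ?_⟩
  filter_upwards [hCD, eventually_ge_atTop 1] with n ⟨hq2, hc0, h1, h2, h3, h4, h5⟩ hn
  have hlog : 0 ≤ Real.log n := Real.log_nonneg (by exact_mod_cast hn)
  have hqc : (1 : ℝ) ≤ c n * (q n : ℝ) ^ 2 ^ h := by
    exact_mod_cast Nat.one_le_iff_ne_zero.2 (by positivity)
  have hκ : 0 ≤ C * (n : ℝ) ^ ageExponent h := by positivity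
  have hup := secondMomentLE_duration hlam v hqc hκ hr
    (fun j hj => hj₀ j (Finset.mem_range.2 (by omega)))
    (fun s hs => bounded_of_mem_stages v (by omega) hc0 h1 h2 hs) (hK v (q n) (c n))
  have hlog3 : 0 ≤ Real.log (3 * (c n * (q n : ℝ) ^ 2 ^ h)) := Real.log_nonneg (by linarith)
  refine ⟨hup.mono hup.measurable hup.nonneg (.of_forall fun _ => le_rfl) (by positivity) ?_, ?_⟩
  · calc _ ≤ K * (C * (n : ℝ) ^ ageExponent h * (4 / lam j₀ * (2 * Real.log n))) := by gcongr
      _ = _ := by ring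
  · refine le_trans ?_ (le_integral_duration hlam v hq2 hc0 (hup.memLp.integrable one_le_two))
    have hothers := v.le_others (by omega : 1 ≤ q n)
    have hq1 : (2 : ℝ) ≤ q n := by exact_mod_cast hq2
    have h6 := h5.trans (Real.log_le_log (by linarith) hothers)
    calc _ = D * (n : ℝ) ^ ageExponent h *
          (ageExponent h / 2 * Real.log n / (2 * lam (h + 1))) := by ring
      _ ≤ _ := by gcongr

end Asymptotics

end HierarchicalAge

theorem theorem3 :
    (∀ (h : ℕ) (lam : ℕ → ℝ) (_ : ∀ j, 0 < lam j) (q c : ℕ → ℕ)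
      (_ : (fun n => (q n : ℝ)) =Θ[atTop] fun n => (n : ℝ) ^ HierarchicalAge.ageExponent h)
      (_ : (fun n => (c n : ℝ)) =Θ[atTop]
        fun n => (n : ℝ) ^ (1 - 2 ^ h * HierarchicalAge.ageExponent h))
      (v : HierarchicalAge.Variant),
      ∃ Δ : ℕ → ℝ,
        (∀ᶠ n in atTop, ∀ (Ω : Type*) [MeasurableSpace Ω] (P : Measure Ω) [IsProbabilityMeasure P]
          (X : ℕ → HierarchicalAge.Transmission → Ω → ℝ),
          HierarchicalAge.IsDelayFamily P lam X →
            ∀ᵐ ω ∂P, HierarchicalAge.HasAverageAge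
              (HierarchicalAge.sessionTime v h (q n) (c n) fun j i => X j i ω) (Δ n)) ∧
        Δ =O[atTop] fun n => (n : ℝ) ^ HierarchicalAge.ageExponent h * Real.log n) ∧
    Tendsto HierarchicalAge.ageExponent atTop (𝓝 0) ∧
    ∀ n : ℕ, 1 ≤ n →
      Tendsto (fun h => (n : ℝ) ^ HierarchicalAge.ageExponent h * Real.log n) atTop
        (𝓝 (Real.log n)) := by
  refine ⟨fun h lam hlam q c hq hc v => ?_, HierarchicalAge.tendsto_ageExponent, fun n hn => ?_⟩
  · obtain ⟨a, b, ha, hb, hab⟩ := HierarchicalAge.exists_duration_bounds h hlam hq hc v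
    have hpos : ∀ᶠ n : ℕ in atTop, 0 < (n : ℝ) ^ HierarchicalAge.ageExponent h * Real.log n := by
      filter_upwards [eventually_ge_atTop 2] with n hn
      have hn' : (1 : ℝ) < n := by exact_mod_cast hn
      exact mul_pos (Real.rpow_pos_of_pos (by linarith) _) (Real.log_pos hn')
    refine ⟨fun n => HierarchicalAge.averageAge lam v h (q n) (c n), ?_,
      IsBigO.of_bound (a + a ^ 2 / (2 * b)) ?_⟩
    · filter_upwards [hab, hpos] with n ⟨hup, hlow⟩ hn Ω _ P _ X hX
      exact HierarchicalAge.ae_hasAverageAge_sessionTime hlam v hup.memLp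
        ((mul_pos hb hn).trans_le hlow) hX
    · filter_upwards [hab, hpos] with n ⟨hup, hlow⟩ hn
      rw [Real.norm_of_nonneg hn.le]
      exact HierarchicalAge.averageAge_bounds hlam ha hb hn hup hlow
  · have hn0 : (n : ℝ) ≠ 0 := by positivity
    have h := (tendsto_const_nhds (x := (n : ℝ))).rpow HierarchicalAge.tendsto_ageExponent
      (Or.inl hn0)
    simpa using h.mul_const (Real.log n)
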